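/- For a sequence $\mathbf{s}=(s_1,\dots,s_m)$ of positive integers, let $$\mathcal{P}_m^{\mathbf{s}}=\Bigl\{x\in\mathbb{R}^m : 0\le \tfrac{x_1}{s_1}\le\cdots\le\tfrac{x_m}{s_m}\le 1\Bigr\}$$ be the $\mathbf{s}$-lecture hall simplex. For a $d$-dimensional lattice polytope $P\subset\mathbb{R}^m$, the $h^*$-polynomial $h^*_P$ is the polynomial of degree at most $d$ with integer coefficients such that $$\sum_{k\ge 0}|kP\cap\mathbb{Z}^m|\,z^k=\frac{h^*_P(z)}{(1-z)^{d+1}}.$$ Proposition 3.1. Let $n\ge 1$, let $s_1,\dots,s_n$ be positive integers, and put $\mathbf{s}'=(s_1,\dots,s_n)$, $(\mathbf{s}',s_n)=(s_1,\dots,s_n,s_n)$ and $\mathbf{s}=(s_1,\dots,s_n,s_n+1)$. Then the $h^*$-polynomials of $\mathcal{P}_{n+1}^{\mathbf{s}}$, $\mathcal{P}_{n+1}^{(\mathbf{s}',s_n)}$ and $\mathcal{P}_n^{\mathbf{s}'}$ exist, and $$h^*_{\mathcal{P}_{n+1}^{\mathbf{s}}}(t)=h^*_{\mathcal{P}_{n+1}^{(\mathbf{s}',s_n)}}(t)+t\cdot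 h^*_{\mathcal{P}_n^{\mathbf{s}'}}(t).$$ -/

import Mathlib

open scoped Pointwise

noncomputable section

namespace Ehrhart

/-- The lattice point enumerator `t ↦ |tP ∩ ℤⁿ|` of a set `P ⊆ ℝⁿ` (the Ehrhart polynomial,
when `P` is a lattice polytope). -/
def latticePointCount {n : ℕ} (P : Set (Fin n → ℝ)) (t : ℕ) : ℕ :=
  {z : Fin n → ℤ | (fun i => (z i : ℝ)) ∈ (t : ℝ) • P}.ncard

/-- The dimension of `P`, that is, of its affine span. -/
def dimension {n : ℕ} (P : Set (Fin n → ℝ)) : ℕ :=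
  Module.finrank ℝ (vectorSpan ℝ P)

/-- The Ehrhart series `∑_{t ≥ 0} |tP ∩ ℤⁿ| zᵗ`. -/
def ehrhartSeries {n : ℕ} (P : Set (Fin n → ℝ)) : PowerSeries ℤ :=
  PowerSeries.mk fun t => (latticePointCount P t : ℤ)

/-- `h` is the `h*`-polynomial of `P`: with `d` the dimension of `P`, the degree of `h` is at most
`d`, and the Ehrhart series of `P` is `h(z) / (1 - z)^(d + 1)`. -/
def IsHStarPolynomial {n : ℕ} (P : Set (Fin n → ℝ)) (h : Polynomial ℤ) : Prop :=
  h.natDegree ≤ dimension P ∧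
    ehrhartSeries P * (1 - PowerSeries.X) ^ (dimension P + 1) = (h : PowerSeries ℤ)

/-- The `h*`-polynomial of `P`: the terms of degree at most `d = dim P` of
`(1 - z)^(d + 1) · ∑ |tP ∩ ℤⁿ| zᵗ`. When `P` has an `h*`-polynomial, this is it, by
`IsHStarPolynomial.eq_hStarPolynomial`. -/
def hStarPolynomial {n : ℕ} (P : Set (Fin n → ℝ)) : Polynomial ℤ :=
  PowerSeries.trunc (dimension P + 1)
    (ehrhartSeries P * (1 - PowerSeries.X) ^ (dimension P + 1))

theorem IsHStarPolynomial.eq_hStarPolynomial {n : ℕ} {P : Set (Fin n → ℝ)} {h : Polynomial ℤ}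
    (hh : IsHStarPolynomial P h) : h = hStarPolynomial P := by
  rw [hStarPolynomial, hh.2]
  exact (PowerSeries.trunc_coe_eq_self (Nat.lt_succ_of_le hh.1)).symm

/-- The `s`-lecture hall simplex `{x ∈ ℝⁿ : 0 ≤ x₁/s₁ ≤ ⋯ ≤ xₙ/sₙ ≤ 1}`. -/
def lectureHallSimplex {n : ℕ} (s : Fin n → ℕ) : Set (Fin n → ℝ) :=
  {x | (∀ i, 0 ≤ x i / s i) ∧ (Monotone fun i => x i / (s i : ℝ)) ∧ ∀ i, x i / s i ≤ 1}

/-- The sequence `(s₁, …, sₙ, a)` of length `n + 1`. -/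
def appendEntry {n : ℕ} (s : Fin n → ℕ) (a : ℕ) : Fin (n + 1) → ℕ :=
  Fin.snoc (α := fun _ => ℕ) s a

end Ehrhart

end

/-! Slice by the last coordinate: passing from the `t`-th to the `(t+1)`-st dilate of the simplex of
`(s', a)` adds `a` slices, the point sets of `s'` with bounds `t + i/a`, `1 ≤ i ≤ a`. Take `a = sₙ`.
For last entry `a + 1` the new bounds are `t + (j+1)/(a+1)`, `0 ≤ j ≤ a`. A slice depends on its
bound `b` only through `⌊b * a⌋`, here `t * a + j`, so these slices have the sizes of those with
bounds `t + j/a`. The terms `j ≥ 1` are the new slices for `(s', a)`; `j = 0` gives the `t`-th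
dilate for `s'`. Hence `(1 - z) E_P = (1 - z) E_Q + z E_R` for the Ehrhart series
(`ncard_lectureHallPoints_appendEntry_succ`), and a power of `1 - z` turns this into the claim.

Existence: slicing lowers the dimension with each difference, so the `(d+1)`-st difference of the
count vanishes (`fwdDiff_iterate_ncard_lectureHallPoints`). -/

theorem PowerSeries.coeff_mk_mul_one_sub_X_pow (f : ℕ → ℤ) (k m : ℕ) :
    PowerSeries.coeff (m + k) (PowerSeries.mk f * (1 - PowerSeries.X) ^ k) =
      (fwdDiff 1)^[k] f m := by
  induction k generalizing m with
  | zero => simp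
  | succ k ih =>
    rw [pow_succ, ← mul_assoc, mul_sub, mul_one, map_sub, ← add_assoc,
      PowerSeries.coeff_succ_mul_X, ih, Function.iterate_succ_apply', fwdDiff, ← ih (m + 1)]
    congr 3
    omega

theorem Fin.monotone_iff_castSucc_last {α : Type*} [Preorder α] {n : ℕ} {f : Fin (n + 1) → α} :
    Monotone f ↔ (Monotone fun i : Fin n => f i.castSucc) ∧ ∀ i : Fin n, f i.castSucc ≤ f (last n) := by
  constructor
  · intro h
    exact ⟨fun i j hij => h (Fin.castSucc_le_castSucc_iff.2 hij), fun i => h (Fin.le_last _)⟩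
  · rintro ⟨h1, h2⟩ i j hij
    induction j using Fin.lastCases with
    | last =>
      induction i using Fin.lastCases with
      | last => exact le_rfl
      | cast i => exact h2 i
    | cast j =>
      induction i using Fin.lastCases with
      | last => exact absurd hij (not_le.2 (Fin.castSucc_lt_last j))
      | cast i => exact h1 (Fin.castSucc_le_castSucc_iff.1 hij)

namespace Ehrhart

/-- The integer points `z` with `0 ≤ z₁/s₁ ≤ ⋯ ≤ zₙ/sₙ ≤ b`. -/
def lectureHallPoints {n : ℕ} (s : Fin n → ℕ) (b : ℝ) : Set (Fin n → ℤ) :=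
  {z | (∀ i, 0 ≤ (z i : ℝ) / s i) ∧ (Monotone fun i => (z i : ℝ) / (s i : ℝ)) ∧
    ∀ i, (z i : ℝ) / s i ≤ b}

theorem appendEntry_castSucc {n : ℕ} (s : Fin n → ℕ) (a : ℕ) (i : Fin n) :
    appendEntry s a i.castSucc = s i :=
  Fin.snoc_castSucc (α := fun _ => ℕ) _ _ _

theorem appendEntry_last {n : ℕ} (s : Fin n → ℕ) (a : ℕ) :
    appendEntry s a (Fin.last n) = a :=
  Fin.snoc_last (α := fun _ => ℕ) _ _

theorem appendEntry_init_last {n : ℕ} (s : Fin (n + 1) → ℕ) :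
    appendEntry (fun i => s i.castSucc) (s (Fin.last n)) = s :=
  Fin.snoc_init_self (α := fun _ => ℕ) s

theorem appendEntry_pos {n : ℕ} {s : Fin n → ℕ} (hs : ∀ i, 0 < s i) {a : ℕ} (ha : 0 < a)
    (i : Fin (n + 1)) : 0 < appendEntry s a i := by
  induction i using Fin.lastCases with
  | last => rwa [appendEntry_last]
  | cast i => rw [appendEntry_castSucc]; exact hs i

/-! ### Lattice points of dilates and their slices -/

theorem smul_lectureHallSimplex {n : ℕ} {s : Fin n → ℕ} (hs : ∀ i, 0 < s i) {b : ℝ} (hb : 0 ≤ b) :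
    b • lectureHallSimplex s =
      {x : Fin n → ℝ | (∀ i, 0 ≤ x i / s i) ∧ (Monotone fun i => x i / (s i : ℝ)) ∧
        ∀ i, x i / s i ≤ b} := by
  have hs' (i : Fin n) : (0 : ℝ) < s i := by exact_mod_cast hs i
  rcases hb.eq_or_lt with rfl | hb
  · have hne : (lectureHallSimplex s).Nonempty :=
      ⟨0, by simp [lectureHallSimplex, monotone_const]⟩
    rw [Set.zero_smul_set hne]
    ext x
    constructor
    · rintro rfl
      simp [monotone_const]
    · rintro ⟨h0, -, h1⟩
      refine funext fun i => ?_
      have := (div_eq_zero_iff.1 (le_antisymm (h1 i) (h0 i)))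
      exact this.resolve_right (hs' i).ne'
  · ext x
    rw [Set.mem_smul_set_iff_inv_smul_mem₀ hb.ne']
    have key (i : Fin n) : (b⁻¹ • x) i / s i = b⁻¹ * (x i / s i) := by
      simp [mul_div_assoc]
    have hb' : 0 < b⁻¹ := inv_pos.2 hb
    simp only [lectureHallSimplex, Set.mem_ofPred_eq, key, Monotone, mul_le_mul_iff_right₀ hb',
      mul_nonneg_iff_of_pos_left hb', inv_mul_le_iff₀ hb, mul_one]

theorem latticePointCount_lectureHallSimplex {n : ℕ} {s : Fin n → ℕ} (hs : ∀ i, 0 < s i) (t : ℕ) :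
    latticePointCount (lectureHallSimplex s) t = (lectureHallPoints s t).ncard := by
  rw [latticePointCount, smul_lectureHallSimplex hs t.cast_nonneg]
  rfl

theorem finite_lectureHallPoints {n : ℕ} {s : Fin n → ℕ} (hs : ∀ i, 0 < s i) (b : ℝ) :
    (lectureHallPoints s b).Finite := by
  refine (Set.Finite.pi' fun i => Set.finite_Icc (0 : ℤ) ⌊b * s i⌋).subset ?_
  rintro z ⟨h0, -, h1⟩ i
  have hi : (0 : ℝ) < s i := by exact_mod_cast hs i
  refine ⟨?_, Int.le_floor.2 ((div_le_iff₀ hi).1 (h1 i))⟩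
  have := (le_div_iff₀ hi).1 (h0 i)
  rw [zero_mul] at this
  exact_mod_cast this

theorem snoc_mem_lectureHallPoints {n : ℕ} {s : Fin n → ℕ} {a : ℕ} {b : ℝ} {w : Fin n → ℤ}
    {m : ℤ} :
    (Fin.snoc (α := fun _ => ℤ) w m : Fin (n + 1) → ℤ) ∈ lectureHallPoints (appendEntry s a) b ↔
      w ∈ lectureHallPoints s ((m : ℝ) / a) ∧ 0 ≤ (m : ℝ) / a ∧ (m : ℝ) / a ≤ b := by
  simp only [lectureHallPoints, Set.mem_ofPred_eq, Fin.monotone_iff_castSucc_last,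
    Fin.forall_fin_succ', appendEntry_castSucc, appendEntry_last, Fin.snoc_castSucc, Fin.snoc_last]
  constructor
  · rintro ⟨⟨h1, h2⟩, ⟨h3, h4⟩, h5, h6⟩
    exact ⟨⟨h1, h3, h4⟩, h2, h6⟩
  · rintro ⟨⟨h1, h3, h4⟩, h2, h6⟩
    exact ⟨⟨h1, h2⟩, ⟨h3, h4⟩, fun i => (h4 i).trans h6, h6⟩

theorem ncard_lectureHallPoints_appendEntry {n : ℕ} {s : Fin n → ℕ} (hs : ∀ i, 0 < s i) {a : ℕ}
    (ha : 0 < a) {b : ℝ} (hb : 0 ≤ b) :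
    (lectureHallPoints (appendEntry s a) b).ncard =
      ∑ m ∈ Finset.range (⌊b * a⌋₊ + 1), (lectureHallPoints s ((m : ℝ) / a)).ncard := by
  have ha' : (0 : ℝ) < a := by exact_mod_cast ha
  have hle (m : ℕ) : (m : ℝ) / a ≤ b ↔ m < ⌊b * a⌋₊ + 1 := by
    rw [Nat.lt_succ_iff, Nat.le_floor_iff (by positivity), div_le_iff₀ ha']
  let φ : (Σ m : Fin (⌊b * a⌋₊ + 1), lectureHallPoints s (((m : ℕ) : ℝ) / a)) →
      lectureHallPoints (appendEntry s a) b := fun p =>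
    ⟨Fin.snoc (α := fun _ => ℤ) p.2.1 ((p.1 : ℕ) : ℤ), snoc_mem_lectureHallPoints.2
      ⟨by simp, by positivity, by simpa using (hle p.1).2 p.1.2⟩⟩
  have hφ : Function.Bijective φ := by
    constructor
    · rintro ⟨m, w, hw⟩ ⟨m', w', hw'⟩ h
      have h' : (Fin.snoc (α := fun _ => ℤ) w (m : ℕ) : Fin (n + 1) → ℤ) =
        Fin.snoc (α := fun _ => ℤ) w' (m' : ℕ) := congrArg Subtype.val h
      obtain ⟨rfl, h2⟩ := Fin.snoc_injective2 h'
      obtain rfl : m = m' := Fin.ext (by exact_mod_cast h2)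
      rfl
    · rintro ⟨z, hz⟩
      obtain ⟨w, m, rfl⟩ : ∃ (w : Fin n → ℤ) (m : ℤ), z = Fin.snoc (α := fun _ => ℤ) w m :=
        ⟨_, _, (Fin.snoc_init_self z).symm⟩
      obtain ⟨h1, h2, h3⟩ := snoc_mem_lectureHallPoints.1 hz
      have hm : 0 ≤ m := by
        have := (le_div_iff₀ ha').1 h2
        rw [zero_mul] at this
        exact_mod_cast this
      lift m to ℕ using hm
      exact ⟨⟨⟨m, (hle m).1 (by simpa using h3)⟩, w, by simpa using h1⟩, rfl⟩
  have (m : Fin (⌊b * a⌋₊ + 1)) : Finite (lectureHallPoints s (((m : ℕ) : ℝ) / a)) :=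
    finite_lectureHallPoints hs _
  rw [← Nat.card_coe_set_eq, ← Nat.card_congr (Equiv.ofBijective φ hφ), Nat.card_sigma,
    Finset.sum_range]
  simp only [Nat.card_coe_set_eq]

theorem ncard_lectureHallPoints_appendEntry_add_one {n : ℕ} {s : Fin n → ℕ} (hs : ∀ i, 0 < s i)
    {a : ℕ} (ha : 0 < a) {b : ℝ} (hb : 0 ≤ b) :
    (lectureHallPoints (appendEntry s a) (b + 1)).ncard =
      (lectureHallPoints (appendEntry s a) b).ncard +
      ∑ j ∈ Finset.range a,
        (lectureHallPoints s (((⌊b * a⌋₊ + 1 + j : ℕ) : ℝ) / a)).ncard := by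
  have : ⌊(b + 1) * a⌋₊ + 1 = ⌊b * a⌋₊ + 1 + a := by
    rw [add_mul, one_mul, Nat.floor_add_natCast (by positivity)]
    ring
  rw [ncard_lectureHallPoints_appendEntry hs ha (by positivity), this, Finset.sum_range_add,
    ncard_lectureHallPoints_appendEntry hs ha hb]

/-! ### Existence of the `h*`-polynomials -/

/-- The real offset `b` is what makes the induction close: a first difference is a sum of counts one
dimension lower, with fractional offsets. -/
theorem fwdDiff_iterate_ncard_lectureHallPoints {n : ℕ} {s : Fin n → ℕ} (hs : ∀ i, 0 < s i)
    {b : ℝ} (hb : 0 ≤ b) :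
    (fwdDiff 1)^[n + 1] (fun t : ℕ => ((lectureHallPoints s (b + t)).ncard : ℤ)) = 0 := by
  induction n generalizing b with
  | zero =>
    have h (c : ℝ) : lectureHallPoints s c = Set.univ :=
      Set.eq_univ_of_forall fun z => by simp [lectureHallPoints, Monotone]
    ext t
    simp [h, fwdDiff]
  | succ n ih =>
    rw [← appendEntry_init_last s]
    set a := s (Fin.last n)
    have ha : 0 < a := hs _
    have ha' : (0 : ℝ) < a := by exact_mod_cast ha
    have hs₀ : ∀ i : Fin n, 0 < s i.castSucc := fun i => hs _
    have key : fwdDiff 1 (fun t : ℕ => ((lectureHallPoints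
          (appendEntry (fun i => s i.castSucc) a) (b + t)).ncard : ℤ)) =
        ∑ j ∈ Finset.range a, fun t : ℕ => ((lectureHallPoints (fun i : Fin n => s i.castSucc)
          (((⌊b * a⌋₊ + 1 + j : ℕ) : ℝ) / a + t)).ncard : ℤ) := by
      ext t
      have hfl : ⌊(b + t) * a⌋₊ = ⌊b * a⌋₊ + t * a := by
        rw [add_mul, ← Nat.cast_mul, Nat.floor_add_natCast (by positivity)]
      rw [fwdDiff, Nat.cast_add_one, ← add_assoc,
        ncard_lectureHallPoints_appendEntry_add_one hs₀ ha (by positivity), Finset.sum_apply, hfl]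
      push_cast
      rw [add_sub_cancel_left]
      refine Finset.sum_congr rfl fun j _ => ?_
      congr 3
      field_simp
      ring
    rw [Function.iterate_succ_apply, key, fwdDiff_iter_finsetSum]
    exact Finset.sum_eq_zero fun j _ => ih hs₀ (by positivity)

theorem dimension_lectureHallSimplex {n : ℕ} {s : Fin n → ℕ} (hs : ∀ i, 0 < s i) :
    dimension (lectureHallSimplex s) = n := by
  have hs' (i : Fin n) : (0 : ℝ) < s i := by exact_mod_cast hs i
  let v (k : ℕ) (i : Fin n) : ℝ := if k ≤ i then s i else 0
  have hdiv (k : ℕ) (i : Fin n) : v k i / s i = if k ≤ i then 1 else 0 := by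
    simp only [v]
    split_ifs
    · exact div_self (hs' i).ne'
    · exact zero_div _
  have hv (k : ℕ) : v k ∈ lectureHallSimplex s := by
    simp only [lectureHallSimplex, Set.mem_ofPred_eq, hdiv]
    refine ⟨fun i => by split_ifs <;> norm_num, fun i j hij => ?_,
      fun i => by split_ifs <;> norm_num⟩
    have : (i : ℕ) ≤ j := hij
    dsimp only
    split_ifs <;> first | omega | norm_num
  have htop : vectorSpan ℝ (lectureHallSimplex s) = ⊤ := by
    refine eq_top_iff.2 fun x _ => ?_
    -- The `v k` are the vertices, and `v k - v (k + 1)` is `s k` times the `k`-th basis vector.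
    have hx : x = ∑ k : Fin n, (x k / s k) • (v k -ᵥ v (k + 1)) := by
      ext i
      rw [Finset.sum_apply, Finset.sum_eq_single i]
      · simp [v, (hs' i).ne']
      · intro k _ hk
        have hk' : (k : ℕ) ≠ i := fun h => hk (Fin.ext h)
        have : (k : ℕ) ≤ i ↔ (k : ℕ) + 1 ≤ i := by omega
        simp only [Pi.smul_apply, vsub_eq_sub, Pi.sub_apply, v, this, sub_self, smul_zero]
      · simp
    rw [hx]
    exact Submodule.sum_mem _ fun k _ =>
      Submodule.smul_mem _ _ (vsub_mem_vectorSpan ℝ (hv _) (hv _))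
  rw [dimension, htop, finrank_top, Module.finrank_fin_fun]

/-- The coefficients beyond degree `d = dimension P` are values of the `(d+1)`-st difference, so
truncation discards only zeros. -/
theorem isHStarPolynomial_of_fwdDiff_eq_zero {n : ℕ} {P : Set (Fin n → ℝ)}
    (h : (fwdDiff 1)^[dimension P + 1] (fun t : ℕ => (latticePointCount P t : ℤ)) = 0) :
    IsHStarPolynomial P (hStarPolynomial P) := by
  refine ⟨Nat.lt_succ_iff.1 (PowerSeries.natDegree_trunc_lt _ _), ?_⟩
  ext m
  rw [hStarPolynomial, Polynomial.coeff_coe, PowerSeries.coeff_trunc]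
  split_ifs with hm
  · rfl
  · obtain ⟨k, rfl⟩ := Nat.exists_eq_add_of_le' (not_lt.1 hm)
    rw [ehrhartSeries, PowerSeries.coeff_mk_mul_one_sub_X_pow, h, Pi.zero_apply]

theorem isHStarPolynomial_lectureHallSimplex {n : ℕ} {s : Fin n → ℕ} (hs : ∀ i, 0 < s i) :
    IsHStarPolynomial (lectureHallSimplex s) (hStarPolynomial (lectureHallSimplex s)) := by
  refine isHStarPolynomial_of_fwdDiff_eq_zero ?_
  rw [dimension_lectureHallSimplex hs]
  simpa [latticePointCount_lectureHallSimplex hs] using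
    fwdDiff_iterate_ncard_lectureHallPoints hs le_rfl

/-! ### The recurrence -/

theorem ncard_lectureHallPoints_congr {n : ℕ} {s : Fin (n + 1) → ℕ} (hs : ∀ i, 0 < s i) {b c : ℝ}
    (hb : 0 ≤ b) (hc : 0 ≤ c) (h : ⌊b * s (Fin.last n)⌋₊ = ⌊c * s (Fin.last n)⌋₊) :
    (lectureHallPoints s b).ncard = (lectureHallPoints s c).ncard := by
  rw [← appendEntry_init_last s, ncard_lectureHallPoints_appendEntry (fun i => hs _) (hs _) hb,
    ncard_lectureHallPoints_appendEntry (fun i => hs _) (hs _) hc, h]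

/-- The lattice point counts of the simplices of `(s', sₙ + 1)` and `(s', sₙ)` have first
differences that differ by the count of the simplex of `s'`. -/
theorem ncard_lectureHallPoints_appendEntry_succ {n : ℕ} {s : Fin (n + 1) → ℕ}
    (hs : ∀ i, 0 < s i) (t : ℕ) :
    (lectureHallPoints (appendEntry s (s (Fin.last n) + 1)) (t + 1)).ncard +
        (lectureHallPoints (appendEntry s (s (Fin.last n))) t).ncard =
      (lectureHallPoints (appendEntry s (s (Fin.last n))) (t + 1)).ncard +
        (lectureHallPoints (appendEntry s (s (Fin.last n) + 1)) t).ncard +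
        (lectureHallPoints s t).ncard := by
  have ht : (0 : ℝ) ≤ t := t.cast_nonneg
  have ha : 0 < s (Fin.last n) := hs _
  have hcongr := fun {b c : ℝ} => ncard_lectureHallPoints_congr hs (b := b) (c := c)
  rw [ncard_lectureHallPoints_appendEntry_add_one hs (Nat.succ_pos _) ht,
    ncard_lectureHallPoints_appendEntry_add_one hs ha ht]
  generalize s (Fin.last n) = a at *
  have ha' : (0 : ℝ) < a := by exact_mod_cast ha
  have hfl (c : ℕ) : ⌊(t : ℝ) * c⌋₊ = t * c := by rw [← Nat.cast_mul, Nat.floor_natCast]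
  have hsum : ∑ j ∈ Finset.range (a + 1), (lectureHallPoints s
        (((⌊(t : ℝ) * (a + 1 : ℕ)⌋₊ + 1 + j : ℕ) : ℝ) / (a + 1 : ℕ))).ncard =
      ∑ j ∈ Finset.range (a + 1), (lectureHallPoints s (((t * a + j : ℕ) : ℝ) / a)).ncard := by
    refine Finset.sum_congr rfl fun j hj => ?_
    rw [Finset.mem_range] at hj
    refine hcongr (by positivity) (by positivity) ?_
    rw [div_mul_cancel₀ _ ha'.ne', Nat.floor_natCast, hfl, div_mul_eq_mul_div, ← Nat.cast_mul,
      Nat.floor_div_natCast, Nat.floor_natCast]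
    -- `(t(a+1) + 1 + j) a` exceeds `(ta + j)(a+1)` by `a - j ≥ 0` and falls short of `(ta + j +
    -- 1)(a+1)` by `j + 1 > 0`.
    refine Nat.div_eq_of_lt_le ?_ ?_
    · nlinarith
    · nlinarith
  -- The split-off term `j = 0` has bound exactly `t`: the extra summand.
  rw [hsum, Finset.sum_range_succ', hfl]
  have h0 : ((t * a + 0 : ℕ) : ℝ) / a = t := by
    rw [add_zero, Nat.cast_mul, mul_div_cancel_right₀ _ ha'.ne']
  rw [h0]
  simp only [add_assoc, add_comm 1]
  ring

theorem ehrhartSeries_appendEntry_succ {n : ℕ} {s : Fin (n + 1) → ℕ} (hs : ∀ i, 0 < s i) :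
    ehrhartSeries (lectureHallSimplex (appendEntry s (s (Fin.last n) + 1))) *
        (1 - PowerSeries.X) =
      ehrhartSeries (lectureHallSimplex (appendEntry s (s (Fin.last n)))) * (1 - PowerSeries.X) +
        PowerSeries.X * ehrhartSeries (lectureHallSimplex s) := by
  ext m
  have hP := appendEntry_pos hs (Nat.succ_pos (s (Fin.last n)))
  have hQ := appendEntry_pos hs (hs (Fin.last n))
  rw [mul_comm PowerSeries.X]
  cases m with
  | zero =>
    simp [ehrhartSeries, mul_sub, latticePointCount_lectureHallSimplex hP,
      latticePointCount_lectureHallSimplex hQ, ncard_lectureHallPoints_appendEntry hs, hs]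
  | succ t =>
    have := ncard_lectureHallPoints_appendEntry_succ hs t
    zify at this
    simp only [ehrhartSeries, mul_sub, mul_one, map_sub, map_add, PowerSeries.coeff_succ_mul_X,
      PowerSeries.coeff_mk, latticePointCount_lectureHallSimplex hP,
      latticePointCount_lectureHallSimplex hQ, latticePointCount_lectureHallSimplex hs]
    push_cast
    linarith

theorem hStarPolynomial_appendEntry_succ {n : ℕ} {s : Fin (n + 1) → ℕ} (hs : ∀ i, 0 < s i) :
    hStarPolynomial (lectureHallSimplex (appendEntry s (s (Fin.last n) + 1))) =
      hStarPolynomial (lectureHallSimplex (appendEntry s (s (Fin.last n)))) +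
        Polynomial.X * hStarPolynomial (lectureHallSimplex s) := by
  have hP := appendEntry_pos hs (Nat.succ_pos (s (Fin.last n)))
  have hQ := appendEntry_pos hs (hs (Fin.last n))
  apply Polynomial.coe_injective ℤ
  rw [Polynomial.coe_add, Polynomial.coe_mul, Polynomial.coe_X,
    ← (isHStarPolynomial_lectureHallSimplex hP).2, ← (isHStarPolynomial_lectureHallSimplex hQ).2,
    ← (isHStarPolynomial_lectureHallSimplex hs).2, dimension_lectureHallSimplex hP,
    dimension_lectureHallSimplex hQ, dimension_lectureHallSimplex hs]
  linear_combination (1 - PowerSeries.X) ^ (n + 1 + 1) * ehrhartSeries_appendEntry_succ hs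

end Ehrhart

/-- Here `s' = (s₁, …, sₙ)` and `sₙ = s' ⟨n - 1, _⟩`. The first three parts say that each of the
polynomials in the last part really is the numerator of the corresponding Ehrhart series. -/
theorem proposition3p1 (n : ℕ) (hn : 0 < n) (s' : Fin n → ℕ) (hs' : ∀ i, 0 < s' i) :
    let sn : ℕ := s' ⟨n - 1, Nat.sub_lt hn Nat.one_pos⟩
    let P : Set (Fin (n + 1) → ℝ) :=
      Ehrhart.lectureHallSimplex (Ehrhart.appendEntry s' (sn + 1))
    let Q : Set (Fin (n + 1) → ℝ) :=
      Ehrhart.lectureHallSimplex (Ehrhart.appendEntry s' sn)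
    let R : Set (Fin n → ℝ) := Ehrhart.lectureHallSimplex s'
    Ehrhart.IsHStarPolynomial P (Ehrhart.hStarPolynomial P) ∧
    Ehrhart.IsHStarPolynomial Q (Ehrhart.hStarPolynomial Q) ∧
    Ehrhart.IsHStarPolynomial R (Ehrhart.hStarPolynomial R) ∧
    Ehrhart.hStarPolynomial P =
      Ehrhart.hStarPolynomial Q + Polynomial.X * Ehrhart.hStarPolynomial R := by
  obtain ⟨n, rfl⟩ := Nat.exists_eq_succ_of_ne_zero hn.ne'
  intro sn P Q R
  exact ⟨Ehrhart.isHStarPolynomial_lectureHallSimplex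
      (Ehrhart.appendEntry_pos hs' (Nat.succ_pos _)),
    Ehrhart.isHStarPolynomial_lectureHallSimplex (Ehrhart.appendEntry_pos hs' (hs' _)),
    Ehrhart.isHStarPolynomial_lectureHallSimplex hs',
    Ehrhart.hStarPolynomial_appendEntry_succ hs'⟩
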